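/- Let $\mathbb K\in\{\mathbb R,\mathbb C\}$, let $A$ be a (not necessarily unital) Banach algebra over $\mathbb K$ with a bounded approximate left identity, let $G$ be a locally compact Hausdorff group with a fixed left Haar measure, and let $\alpha$ be a strongly continuous homomorphism from $G$ into the group of bounded algebra automorphisms of $A$. A continuous covariant representation $(\pi,U)$ of $(A,G,\alpha)$ on a Banach space $X$ consists of a norm-bounded algebra representation $\pi:A\to B(X)$ and a strongly continuous group representation $U:G\to B(X)$ such that $\pi(\alpha_s(a))=U_s\pi(a)U_s^{-1}$ for all $a\in A$, $s\in G$; it is non-degenerate if the linear span of $\pi(A)X$ is dense in $X$. Let $\mathcal R$ be a non-empty uniformly bounded class of non-degenerate continuous covariant representations, i.e. there are a constant $C\ge 0$ and a function $\nu:G\to[0,\infty)$, bounded on compact sets, such that $\|\pi\|\le C$ and $\|U_r\|\le\nu(r)$ for all $(\pi,U)\in\mathcal R$ and $r\in G$. Equip $C_c(G,A)$ with the twisted convolution $[f*g](s)=\int_G f(r)\,\alpha_r(g(r^{-1}s))\,dr$ and with the algebra seminorm $$\sigma^{\mathcal R}(f)=\sup_{(\pi,U)\in\mathcal R}\|\pi\rtimes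 U(f)\|,\qquad \pi\rtimes U(f)x=\int_G\pi(f(s))U_sx\,ds\quad(x\in X),$$ and let the crossed product $(A\rtimes_\alpha G)^{\mathcal R}$ be the Banach algebra obtained as the completion of $C_c(G,A)/\ker\sigma^{\mathcal R}$. For a Banach algebra $B$, let $\mathcal M_l(B)$ be its left centralizer algebra, i.e. the algebra of all bounded linear operators $L:B\to B$ with $L(ab)=(La)b$ for all $a,b\in B$, with the operator norm. Then the left regular representation $$\lambda:(A\rtimes_\alpha G)^{\mathcal R}\to\mathcal M_l\big((A\rtimes_\alpha G)^{\mathcal R}\big),\qquad \lambda(a)b=ab,$$ is a topological embedding, i.e. a homeomorphism onto its image. (No bounded approximate right identity is assumed to exist in $A$ or in $(A\rtimes_\alpha G)^{\mathcal R}$.) -/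

import Mathlib

open MeasureTheory Filter Topology Set
open scoped CompactlySupported

noncomputable section

namespace BanachCrossedProduct

/-! ### Integration of continuous compactly supported functions -/

section Integral

variable (𝕜 : Type*) [RCLike 𝕜] {G : Type*} [TopologicalSpace G] [MeasurableSpace G]
  {E : Type*} [NormedAddCommGroup E] [NormedSpace 𝕜 E]
  {F : Type*} [NormedAddCommGroup F] [NormedSpace 𝕜 F]

/-- The (Bochner) integral of a function with values in a normed space over `𝕜 = ℝ` or `𝕜 = ℂ`,
the real structure being the restriction of the given `𝕜`-structure. -/
def integralK (μ : Measure G) (f : G → E) : E :=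
  letI : NormedSpace ℝ E := NormedSpace.restrictScalars ℝ 𝕜 E
  ∫ s, f s ∂μ

variable {𝕜} [OpensMeasurableSpace G] {μ : Measure G} [IsFiniteMeasureOnCompacts μ]

theorem integralK_add {f g : G → E} (hf : Continuous f) (hf' : HasCompactSupport f)
    (hg : Continuous g) (hg' : HasCompactSupport g) :
    integralK 𝕜 μ (fun s => f s + g s) = integralK 𝕜 μ f + integralK 𝕜 μ g := by
  let _ : NormedSpace ℝ E := NormedSpace.restrictScalars ℝ 𝕜 E
  exact integral_add (hf.integrable_of_hasCompactSupport hf')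
    (hg.integrable_of_hasCompactSupport hg')

theorem integralK_smul (c : 𝕜) (f : G → E) :
    integralK 𝕜 μ (fun s => c • f s) = c • integralK 𝕜 μ f := by
  let _ : NormedSpace ℝ E := NormedSpace.restrictScalars ℝ 𝕜 E
  have : IsScalarTower ℝ 𝕜 E := RestrictScalars.isScalarTower ℝ 𝕜 E
  have : SMulCommClass ℝ 𝕜 E := IsScalarTower.to_smulCommClass
  exact integral_smul c f

theorem integralK_clm [CompleteSpace E] [CompleteSpace F] (L : E →L[𝕜] F) {f : G → E}
    (hf : Continuous f) (hf' : HasCompactSupport f) :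
    integralK 𝕜 μ (fun s => L (f s)) = L (integralK 𝕜 μ f) := by
  let _ : NormedSpace ℝ E := NormedSpace.restrictScalars ℝ 𝕜 E
  let _ : NormedSpace ℝ F := NormedSpace.restrictScalars ℝ 𝕜 F
  have : IsScalarTower ℝ 𝕜 E := RestrictScalars.isScalarTower ℝ 𝕜 E
  have : IsScalarTower ℝ 𝕜 F := RestrictScalars.isScalarTower ℝ 𝕜 F
  exact L.integral_comp_comm (hf.integrable_of_hasCompactSupport hf')

theorem norm_integralK_le {f : G → E} {b : G → ℝ} (hb : Continuous b) (hb' : HasCompactSupport b)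
    (h : ∀ s, ‖f s‖ ≤ b s) : ‖integralK 𝕜 μ f‖ ≤ ∫ s, b s ∂μ := by
  let _ : NormedSpace ℝ E := NormedSpace.restrictScalars ℝ 𝕜 E
  exact norm_integral_le_of_norm_le (hb.integrable_of_hasCompactSupport hb')
    (Eventually.of_forall h)

theorem integralK_swap {f : G → G → E} (hf : Continuous f.uncurry)
    (hf' : HasCompactSupport f.uncurry) :
    integralK 𝕜 μ (fun x => integralK 𝕜 μ (fun y => f x y)) =
      integralK 𝕜 μ (fun y => integralK 𝕜 μ (fun x => f x y)) := by
  let _ : NormedSpace ℝ E := NormedSpace.restrictScalars ℝ 𝕜 E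
  exact integral_integral_swap_of_hasCompactSupport hf hf'

theorem continuous_integralK {f : G → G → E} {k : Set G} (hk : IsCompact k)
    (hf : Continuous f.uncurry) (hfs : ∀ x y, y ∉ k → f x y = 0) :
    Continuous fun x => integralK 𝕜 μ (fun y => f x y) := by
  let _ : NormedSpace ℝ E := NormedSpace.restrictScalars ℝ 𝕜 E
  rw [← continuousOn_univ]
  exact continuousOn_integral_of_compact_support hk hf.continuousOn (fun x y _ hy => hfs x y hy)

theorem integralK_mul_left [Group G] [MeasurableMul G] [μ.IsMulLeftInvariant]
    (f : G → E) (r : G) : integralK 𝕜 μ (fun s => f (r * s)) = integralK 𝕜 μ f := by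
  let _ : NormedSpace ℝ E := NormedSpace.restrictScalars ℝ 𝕜 E
  exact integral_mul_left_eq_self f r

end Integral

/-! ### Strongly continuous families of operators -/

section StronglyContinuous

variable {𝕜 : Type*} [RCLike 𝕜] {G : Type*} [TopologicalSpace G]
  {E : Type*} [NormedAddCommGroup E] [NormedSpace 𝕜 E] [CompleteSpace E]

theorem exists_norm_le_on_compact {U : G → E →L[𝕜] E} (hU : ∀ x, Continuous fun s => U s x)
    {K : Set G} (hK : IsCompact K) : ∃ M : ℝ, ∀ s ∈ K, ‖U s‖ ≤ M := by
  obtain ⟨M, hM⟩ := banach_steinhaus (g := fun s : K => U s) (fun x => by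
    obtain ⟨C, hC⟩ := hK.exists_bound_of_continuousOn (hU x).continuousOn
    exact ⟨C, fun s => hC s s.2⟩)
  exact ⟨M, fun s hs => hM ⟨s, hs⟩⟩

theorem continuous_uncurry_of_strong [LocallyCompactSpace G] {U : G → E →L[𝕜] E}
    (hU : ∀ x, Continuous fun s => U s x) : Continuous fun p : G × E => U p.1 p.2 := by
  rw [continuous_iff_continuousAt]
  rintro ⟨s₀, x₀⟩
  obtain ⟨K, hK, hs₀⟩ := exists_compact_mem_nhds s₀
  obtain ⟨M, hM⟩ := exists_norm_le_on_compact hU hK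
  have h1 : Tendsto (fun p : G × E => M * ‖p.2 - x₀‖ + ‖U p.1 x₀ - U s₀ x₀‖)
      (𝓝 (s₀, x₀)) (𝓝 0) := by
    have : Continuous fun p : G × E => M * ‖p.2 - x₀‖ + ‖U p.1 x₀ - U s₀ x₀‖ := by
      have := (hU x₀).comp (continuous_fst (X := G) (Y := E))
      simp only [Function.comp_def] at this
      fun_prop
    simpa using this.tendsto (s₀, x₀)
  refine tendsto_iff_norm_sub_tendsto_zero.2 (squeeze_zero' (Eventually.of_forall fun _ =>
    norm_nonneg _) ?_ h1)
  filter_upwards [prod_mem_nhds hs₀ univ_mem] with p hp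
  have : U p.1 p.2 - U s₀ x₀ = U p.1 (p.2 - x₀) + (U p.1 x₀ - U s₀ x₀) := by
    rw [map_sub]; abel
  simp only [this]
  refine (norm_add_le _ _).trans ?_
  gcongr
  exact (U p.1).le_of_opNorm_le (hM _ hp.1) _

end StronglyContinuous

/-! ### Banach algebra dynamical systems and covariant representations -/

/-- A Banach algebra dynamical system `(A, G, α)`: a group homomorphism from `G` to the bounded
algebra automorphisms of `A` that is strongly continuous. (Invertibility of each `α s` is automatic,
as `α` is a homomorphism from a group into the monoid of bounded operators on `A`.) -/
structure DynamicalSystem (𝕜 : Type*) [RCLike 𝕜] (A : Type*) [NonUnitalNormedRing A]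
    [NormedSpace 𝕜 A] (G : Type*) [Group G] [TopologicalSpace G] where
  /-- the action of the group -/
  α : G →* (A →L[𝕜] A)
  map_mul : ∀ s a b, α s (a * b) = α s a * α s b
  continuous_α : ∀ a, Continuous fun s => α s a

/-- `A` has a bounded approximate left identity (a bounded net `u` with `u a → a` for all `a`; a net
enters only through the filter of its tails). -/
def HasBoundedApproxLeftIdentity (A : Type*) [NonUnitalNormedRing A] : Prop :=
  ∃ l : Filter A, l.NeBot ∧ (∃ M : ℝ, ∀ᶠ u in l, ‖u‖ ≤ M) ∧ ∀ a, Tendsto (fun u => u * a) l (𝓝 a)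

section

universe w

variable {𝕜 : Type*} [RCLike 𝕜] {A : Type*} [NonUnitalNormedRing A] [NormedSpace 𝕜 A]
  {G : Type*} [Group G] [TopologicalSpace G]

/-- A continuous covariant representation `(π, U)` of `(A, G, α)` on a Banach space `X`: `π` is
a norm-bounded representation of the algebra, `U` a strongly continuous representation of the group,
and `π (α s a) = U s π(a) (U s)⁻¹`. -/
structure ContCovRep (𝔖 : DynamicalSystem 𝕜 A G) where
  /-- the Banach space -/
  X : Type w
  [instNormedAddCommGroup : NormedAddCommGroup X]
  [instNormedSpace : NormedSpace 𝕜 X]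
  [instCompleteSpace : CompleteSpace X]
  /-- the representation of the algebra -/
  π : A →L[𝕜] (X →L[𝕜] X)
  π_mul : ∀ a b, π (a * b) = π a * π b
  /-- the representation of the group -/
  U : G →* (X →L[𝕜] X)
  continuous_U : ∀ x, Continuous fun s => U s x
  covariant : ∀ s a, π (𝔖.α s a) = U s * π a * U s⁻¹

attribute [instance] ContCovRep.instNormedAddCommGroup ContCovRep.instNormedSpace
  ContCovRep.instCompleteSpace

/-- `(π, U)` is non-degenerate: the linear span of `π(A) X` is dense in `X`. -/
def ContCovRep.IsNondegenerate {𝔖 : DynamicalSystem 𝕜 A G} (ρ : ContCovRep.{w} 𝔖) : Prop :=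
  Dense (Submodule.span 𝕜 {y : ρ.X | ∃ a x, y = ρ.π a x} : Set ρ.X)

/-- A (non-empty) uniformly bounded class of continuous covariant representations. -/
structure UniformlyBoundedClass (𝔖 : DynamicalSystem 𝕜 A G) where
  /-- the members of the class -/
  carrier : Set (ContCovRep.{w} 𝔖)
  nonempty : carrier.Nonempty
  bounded : ∃ (C : ℝ) (ν : G → ℝ), 0 ≤ C ∧ (∀ r, 0 ≤ ν r) ∧
    (∀ K : Set G, IsCompact K → BddAbove (ν '' K)) ∧
    ∀ ρ ∈ carrier, ‖ρ.π‖ ≤ C ∧ ∀ r, ‖ρ.U r‖ ≤ ν r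

end

/-! ### Twisted convolution, integrated forms, the seminorm -/

section

open scoped Pointwise

universe w

variable {𝕜 : Type*} [RCLike 𝕜] {A : Type*} [NonUnitalNormedRing A] [NormedSpace 𝕜 A]
  [IsScalarTower 𝕜 A A] [SMulCommClass 𝕜 A A] [CompleteSpace A]
  {G : Type*} [Group G] [TopologicalSpace G] [IsTopologicalGroup G] [LocallyCompactSpace G]
  [T2Space G] [MeasurableSpace G] [BorelSpace G]
  (μ : Measure G) [μ.IsHaarMeasure] (𝔖 : DynamicalSystem 𝕜 A G)

theorem continuous_convIntegrand (f g : C_c(G, A)) :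
    Continuous (fun p : G × G => f p.2 * 𝔖.α p.2 (g (p.2⁻¹ * p.1))) := by
  have h := continuous_uncurry_of_strong 𝔖.continuous_α
  have h2 : Continuous fun p : G × G => (p.2, g (p.2⁻¹ * p.1)) :=
    continuous_snd.prodMk (g.continuous.comp (by fun_prop))
  exact (f.continuous.comp continuous_snd).mul (h.comp h2)

/-- Twisted convolution `[f * g](s) = ∫ f(r) α_r(g(r⁻¹ s)) dr` on `C_c(G, A)`. -/
def twistedConv (f g : C_c(G, A)) : C_c(G, A) where
  toFun s := integralK 𝕜 μ fun r => f r * 𝔖.α r (g (r⁻¹ * s))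
  continuous_toFun := continuous_integralK (f := fun s r => f r * 𝔖.α r (g (r⁻¹ * s)))
    f.hasCompactSupport (continuous_convIntegrand 𝔖 f g)
    (fun x y hy => by simp [image_eq_zero_of_notMem_tsupport hy])
  hasCompactSupport' := by
    refine HasCompactSupport.intro (K := tsupport f * tsupport g)
      (f.hasCompactSupport.isCompact.mul g.hasCompactSupport.isCompact) fun s hs => ?_
    have : (fun r => f r * 𝔖.α r (g (r⁻¹ * s))) = fun _ => (0 : 𝕜) • (0 : A) := by
      funext r
      by_cases hr : r ∈ tsupport f
      · have : r⁻¹ * s ∉ tsupport g := fun h => hs ⟨r, hr, r⁻¹ * s, h, by simp⟩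
        simp [image_eq_zero_of_notMem_tsupport this]
      · simp [image_eq_zero_of_notMem_tsupport hr]
    rw [this, integralK_smul, zero_smul]

theorem continuous_convIntegrand' (f g : C_c(G, A)) (s : G) :
    Continuous fun r => f r * 𝔖.α r (g (r⁻¹ * s)) :=
  (continuous_convIntegrand 𝔖 f g).comp (continuous_const.prodMk continuous_id)

theorem hasCompactSupport_convIntegrand (f g : C_c(G, A)) (s : G) :
    HasCompactSupport fun r => f r * 𝔖.α r (g (r⁻¹ * s)) :=
  f.hasCompactSupport.mul_right

variable {𝔖}

theorem ContCovRep.continuous_integrand (ρ : ContCovRep.{w} 𝔖) (f : C_c(G, A)) (x : ρ.X) :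
    Continuous fun s => ρ.π (f s) (ρ.U s x) :=
  (ρ.π.continuous.comp f.continuous).clm_apply (ρ.continuous_U x)

theorem ContCovRep.hasCompactSupport_integrand (ρ : ContCovRep.{w} 𝔖) (f : C_c(G, A)) (x : ρ.X) :
    HasCompactSupport fun s => ρ.π (f s) (ρ.U s x) := by
  refine HasCompactSupport.intro f.hasCompactSupport fun s hs => ?_
  simp [image_eq_zero_of_notMem_tsupport hs]

theorem ContCovRep.norm_integrated_le (ρ : ContCovRep.{w} 𝔖) (f : C_c(G, A)) {M C : ℝ}
    (hC : ‖ρ.π‖ ≤ C) (hM : ∀ s ∈ tsupport f, ‖ρ.U s‖ ≤ M) (x : ρ.X) :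
    ‖integralK 𝕜 μ fun s => ρ.π (f s) (ρ.U s x)‖ ≤ (C * M * ∫ s, ‖f s‖ ∂μ) * ‖x‖ := by
  have hb : Continuous fun s => C * M * ‖f s‖ * ‖x‖ := by
    have := f.continuous
    fun_prop
  have hb' : HasCompactSupport fun s => C * M * ‖f s‖ * ‖x‖ := by
    refine HasCompactSupport.intro f.hasCompactSupport fun s hs => ?_
    simp [image_eq_zero_of_notMem_tsupport hs]
  refine (norm_integralK_le (μ := μ) (𝕜 := 𝕜) hb hb' fun s => ?_).trans_eq ?_
  · by_cases hs : s ∈ tsupport f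
    · have h0 : 0 ≤ C := (norm_nonneg ρ.π).trans hC
      calc ‖ρ.π (f s) (ρ.U s x)‖ ≤ ‖ρ.π (f s)‖ * ‖ρ.U s x‖ := (ρ.π (f s)).le_opNorm _
        _ ≤ (C * ‖f s‖) * (M * ‖x‖) := by
          gcongr
          · exact ρ.π.le_of_opNorm_le hC _
          · exact (ρ.U s).le_of_opNorm_le (hM s hs) _
        _ = _ := by ring
    · simp [image_eq_zero_of_notMem_tsupport hs]
  · rw [integral_mul_const, integral_const_mul]

/-- The integrated form `π ⋊ U` of `(π, U)`: `(π ⋊ U)(f) x = ∫ π(f(s)) U_s x ds`. -/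
def ContCovRep.integratedForm (ρ : ContCovRep.{w} 𝔖) : C_c(G, A) →ₗ[𝕜] (ρ.X →L[𝕜] ρ.X) where
  toFun f := LinearMap.mkContinuousOfExistsBound
    { toFun := fun x => integralK 𝕜 μ fun s => ρ.π (f s) (ρ.U s x)
      map_add' := fun x y => by
        simp only [map_add]
        exact integralK_add (ρ.continuous_integrand f x) (ρ.hasCompactSupport_integrand f x)
          (ρ.continuous_integrand f y) (ρ.hasCompactSupport_integrand f y)
      map_smul' := fun c x => by
        simp only [map_smul, RingHom.id_apply]
        exact integralK_smul c _ }
    (by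
      obtain ⟨M, hM⟩ := exists_norm_le_on_compact ρ.continuous_U f.hasCompactSupport.isCompact
      exact ⟨_, fun x => ρ.norm_integrated_le μ f le_rfl hM x⟩)
  map_add' f g := by
    ext x
    have := integralK_add (𝕜 := 𝕜) (μ := μ) (ρ.continuous_integrand f x)
      (ρ.hasCompactSupport_integrand f x) (ρ.continuous_integrand g x)
      (ρ.hasCompactSupport_integrand g x)
    simpa [LinearMap.mkContinuousOfExistsBound] using this
  map_smul' c f := by
    ext x
    have := integralK_smul (𝕜 := 𝕜) (μ := μ) c (fun s => ρ.π (f s) (ρ.U s x))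
    simpa [LinearMap.mkContinuousOfExistsBound] using this

theorem ContCovRep.integratedForm_apply (ρ : ContCovRep.{w} 𝔖) (f : C_c(G, A)) (x : ρ.X) :
    ρ.integratedForm μ f x = integralK 𝕜 μ fun s => ρ.π (f s) (ρ.U s x) := rfl

/-- The integrated form is multiplicative for twisted convolution. -/
theorem ContCovRep.integratedForm_conv (ρ : ContCovRep.{w} 𝔖) (f g : C_c(G, A)) :
    ρ.integratedForm μ (twistedConv μ 𝔖 f g) = ρ.integratedForm μ f * ρ.integratedForm μ g := by
  ext x
  have hU := continuous_uncurry_of_strong ρ.continuous_U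
  have hcov : ∀ r a y, ρ.π (𝔖.α r a) y = ρ.U r (ρ.π a (ρ.U r⁻¹ y)) := fun r a y => by
    rw [ρ.covariant]; rfl
  have hmul : ∀ r s y, ρ.U (r * s) y = ρ.U r (ρ.U s y) := fun r s y => by rw [map_mul]; rfl
  let F : G → G → ρ.X := fun s r => ρ.π (f r) (ρ.U r (ρ.π (g (r⁻¹ * s)) (ρ.U (r⁻¹ * s) x)))
  have hg : Continuous fun p : G × G => ρ.π (g (p.2⁻¹ * p.1)) (ρ.U (p.2⁻¹ * p.1) x) :=
    (ρ.continuous_integrand g x).comp (by fun_prop : Continuous fun p : G × G => p.2⁻¹ * p.1)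
  have hF : Continuous F.uncurry := by
    have h1 : Continuous fun p : G × G =>
        ρ.U p.2 (ρ.π (g (p.2⁻¹ * p.1)) (ρ.U (p.2⁻¹ * p.1) x)) :=
      hU.comp (continuous_snd.prodMk hg)
    exact (ρ.π.continuous.comp (f.continuous.comp continuous_snd)).clm_apply h1
  have hF' : HasCompactSupport F.uncurry := by
    refine HasCompactSupport.intro (K := (tsupport f * tsupport g) ×ˢ tsupport f)
      ((f.hasCompactSupport.isCompact.mul g.hasCompactSupport.isCompact).prod
        f.hasCompactSupport.isCompact) ?_
    rintro ⟨s, r⟩ hp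
    by_cases hr : r ∈ tsupport f
    · have : r⁻¹ * s ∉ tsupport g := fun h => hp ⟨⟨r, hr, r⁻¹ * s, h, by simp⟩, hr⟩
      simp [F, image_eq_zero_of_notMem_tsupport this]
    · simp [F, image_eq_zero_of_notMem_tsupport hr]
  have e1 : ∀ s, ρ.π (twistedConv μ 𝔖 f g s) (ρ.U s x) = integralK 𝕜 μ fun r => F s r := by
    intro s
    have := integralK_clm (μ := μ) ((ContinuousLinearMap.apply 𝕜 ρ.X (ρ.U s x)).comp ρ.π)
      (continuous_convIntegrand' 𝔖 f g s) (hasCompactSupport_convIntegrand 𝔖 f g s)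
    refine Eq.trans this.symm ?_
    congr 1
    funext r
    change ρ.π (f r * 𝔖.α r (g (r⁻¹ * s))) (ρ.U s x) = _
    rw [ρ.π_mul]
    change ρ.π (f r) (ρ.π (𝔖.α r (g (r⁻¹ * s))) (ρ.U s x)) = _
    rw [hcov, ← hmul]
  have e2 : ∀ r, integralK 𝕜 μ (fun s => F s r) = ρ.π (f r) (ρ.U r (ρ.integratedForm μ g x)) := by
    intro r
    have h1 := integralK_mul_left (𝕜 := 𝕜) (μ := μ)
      (fun s => ρ.π (f r) (ρ.U r (ρ.π (g s) (ρ.U s x)))) r⁻¹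
    refine Eq.trans h1 ?_
    exact integralK_clm (μ := μ) ((ρ.π (f r)).comp (ρ.U r))
      (ρ.continuous_integrand g x) (ρ.hasCompactSupport_integrand g x)
  change integralK 𝕜 μ (fun s => ρ.π (twistedConv μ 𝔖 f g s) (ρ.U s x)) =
    integralK 𝕜 μ (fun r => ρ.π (f r) (ρ.U r (ρ.integratedForm μ g x)))
  simp only [e1, ← e2]
  exact integralK_swap hF hF'

variable (R : UniformlyBoundedClass.{w} 𝔖)

theorem bddAbove_norm_integratedForm (f : C_c(G, A)) :
    BddAbove (range fun ρ : R.carrier => ‖ρ.1.integratedForm μ f‖) := by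
  obtain ⟨C, ν, hC, hν, hK, hR⟩ := R.bounded
  obtain ⟨M, hM⟩ := hK _ f.hasCompactSupport.isCompact
  refine ⟨C * max M 0 * ∫ s, ‖f s‖ ∂μ, ?_⟩
  rintro _ ⟨ρ, rfl⟩
  refine ContinuousLinearMap.opNorm_le_bound _ (by positivity) fun x => ?_
  exact ρ.1.norm_integrated_le μ f (hR ρ.1 ρ.2).1 (fun s hs =>
    (((hR ρ.1 ρ.2).2 s).trans (hM ⟨s, hs, rfl⟩)).trans (le_max_left _ _)) x

/-- The seminorm `σ^R(f) = sup_{(π, U) ∈ R} ‖(π ⋊ U)(f)‖` on `C_c(G, A)`. -/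
def sigma : Seminorm 𝕜 C_c(G, A) :=
  Seminorm.of (fun f => ⨆ ρ : R.carrier, ‖ρ.1.integratedForm μ f‖)
    (fun f g => by
      have : Nonempty R.carrier := R.nonempty.to_subtype
      refine ciSup_le fun ρ => ?_
      rw [map_add]
      exact (norm_add_le _ _).trans (add_le_add
        (le_ciSup (bddAbove_norm_integratedForm μ R f) ρ)
        (le_ciSup (bddAbove_norm_integratedForm μ R g) ρ)))
    (fun c f => by
      simp only [map_smul, norm_smul]
      exact (Real.mul_iSup_of_nonneg (norm_nonneg c) _).symm)

theorem sigma_apply (f : C_c(G, A)) :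
    sigma μ R f = ⨆ ρ : R.carrier, ‖ρ.1.integratedForm μ f‖ := rfl

theorem sigma_conv_le (f g : C_c(G, A)) :
    sigma μ R (twistedConv μ 𝔖 f g) ≤ sigma μ R f * sigma μ R g := by
  have : Nonempty R.carrier := R.nonempty.to_subtype
  refine ciSup_le fun ρ => ?_
  rw [ρ.1.integratedForm_conv μ]
  exact (norm_mul_le _ _).trans (mul_le_mul (le_ciSup (bddAbove_norm_integratedForm μ R f) ρ)
    (le_ciSup (bddAbove_norm_integratedForm μ R g) ρ) (norm_nonneg _) (apply_nonneg _ _))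

theorem sigma_eq_zero {f : C_c(G, A)} (hf : ∀ ρ ∈ R.carrier, ρ.integratedForm μ f = 0) :
    sigma μ R f = 0 := by
  have : Nonempty R.carrier := R.nonempty.to_subtype
  rw [sigma_apply]
  simp [fun ρ : R.carrier => hf ρ.1 ρ.2]

/-! ### The crossed product -/

/-- `C_c(G, A)` equipped with the seminorm `σ^R`. -/
def PreCrossedProduct (_μ : Measure G) (_R : UniformlyBoundedClass.{w} 𝔖) : Type _ := C_c(G, A)

instance : AddCommGroup (PreCrossedProduct μ R) := inferInstanceAs (AddCommGroup C_c(G, A))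

instance : Module 𝕜 (PreCrossedProduct μ R) := inferInstanceAs (Module 𝕜 C_c(G, A))

instance : SeminormedAddCommGroup (PreCrossedProduct μ R) :=
  AddGroupSeminorm.toSeminormedAddCommGroup
    (E := PreCrossedProduct μ R) (sigma μ R).toAddGroupSeminorm

theorem PreCrossedProduct.norm_def (f : PreCrossedProduct μ R) : ‖f‖ = sigma μ R f := rfl

instance : NormedSpace 𝕜 (PreCrossedProduct μ R) where
  norm_smul_le c f := (map_smul_eq_mul (sigma μ R) c f).le

/-- Twisted convolution as a bounded bilinear map for `σ^R`. -/
def PreCrossedProduct.conv :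
    PreCrossedProduct μ R →L[𝕜] PreCrossedProduct μ R →L[𝕜] PreCrossedProduct μ R :=
  LinearMap.mkContinuous₂
    (LinearMap.mk₂ 𝕜 (fun f g : PreCrossedProduct μ R =>
        (twistedConv μ 𝔖 f g : PreCrossedProduct μ R))
      (fun f f' g => by
        refine CompactlySupportedContinuousMap.ext fun s => ?_
        refine Eq.trans ?_ (integralK_add (𝕜 := 𝕜) (μ := μ) (continuous_convIntegrand' 𝔖 f g s)
          (hasCompactSupport_convIntegrand 𝔖 f g s) (continuous_convIntegrand' 𝔖 f' g s)
          (hasCompactSupport_convIntegrand 𝔖 f' g s))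
        exact congrArg (integralK 𝕜 μ) (funext fun r => add_mul _ _ _))
      (fun c f g => by
        refine CompactlySupportedContinuousMap.ext fun s => ?_
        refine Eq.trans ?_ (integralK_smul (𝕜 := 𝕜) (μ := μ) c _)
        exact congrArg (integralK 𝕜 μ) (funext fun r => smul_mul_assoc _ _ _))
      (fun f g g' => by
        refine CompactlySupportedContinuousMap.ext fun s => ?_
        refine Eq.trans ?_ (integralK_add (𝕜 := 𝕜) (μ := μ) (continuous_convIntegrand' 𝔖 f g s)
          (hasCompactSupport_convIntegrand 𝔖 f g s) (continuous_convIntegrand' 𝔖 f g' s)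
          (hasCompactSupport_convIntegrand 𝔖 f g' s))
        refine congrArg (integralK 𝕜 μ) (funext fun r => ?_)
        rw [← mul_add, ← map_add]
        rfl)
      (fun c f g => by
        refine CompactlySupportedContinuousMap.ext fun s => ?_
        refine Eq.trans ?_ (integralK_smul (𝕜 := 𝕜) (μ := μ) c _)
        refine congrArg (integralK 𝕜 μ) (funext fun r => ?_)
        rw [← mul_smul_comm, ← map_smul]
        rfl))
    1 (fun f g => by rw [one_mul]; exact sigma_conv_le μ R f g)

/-- The crossed product `(A ⋊_α G)^R`: the completion of `C_c(G, A) / ker σ^R`, where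
`UniformSpace.Completion` performs the passage to the quotient by the kernel of the seminorm. -/
def CrossedProduct (μ : Measure G) [μ.IsHaarMeasure] (R : UniformlyBoundedClass.{w} 𝔖) : Type _ :=
  UniformSpace.Completion (PreCrossedProduct μ R)

namespace CrossedProduct

instance : NormedAddCommGroup (CrossedProduct μ R) :=
  inferInstanceAs (NormedAddCommGroup (UniformSpace.Completion (PreCrossedProduct μ R)))

instance : NormedSpace 𝕜 (CrossedProduct μ R) :=
  inferInstanceAs (NormedSpace 𝕜 (UniformSpace.Completion (PreCrossedProduct μ R)))

instance : CompleteSpace (CrossedProduct μ R) :=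
  inferInstanceAs (CompleteSpace (UniformSpace.Completion (PreCrossedProduct μ R)))

/-- The quotient map `q^R : C_c(G, A) → (A ⋊_α G)^R`. -/
def q : PreCrossedProduct μ R →L[𝕜] CrossedProduct μ R :=
  (UniformSpace.Completion.toComplL :
    PreCrossedProduct μ R →L[𝕜] UniformSpace.Completion (PreCrossedProduct μ R))

theorem norm_q (f : PreCrossedProduct μ R) : ‖q μ R f‖ = sigma μ R f :=
  UniformSpace.Completion.norm_coe f

theorem denseRange_q : DenseRange (q μ R) := UniformSpace.Completion.denseRange_coe

theorem isUniformInducing_q : IsUniformInducing (q μ R) :=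
  UniformSpace.Completion.isUniformInducing_coe _

/-- The product of the crossed product: the continuous bilinear extension of
`(q f, q g) ↦ q (f * g)`. -/
def mulL : CrossedProduct μ R →L[𝕜] CrossedProduct μ R →L[𝕜] CrossedProduct μ R :=
  let c : PreCrossedProduct μ R →L[𝕜] PreCrossedProduct μ R →L[𝕜] CrossedProduct μ R :=
    (ContinuousLinearMap.compL 𝕜 _ _ _ (q μ R)).comp (PreCrossedProduct.conv μ R)
  let c₁ : CrossedProduct μ R →L[𝕜] PreCrossedProduct μ R →L[𝕜] CrossedProduct μ R :=
    c.extend (q μ R)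
  (c₁.flip.extend (q μ R)).flip

theorem mulL_q (f g : PreCrossedProduct μ R) :
    mulL μ R (q μ R f) (q μ R g) = q μ R (PreCrossedProduct.conv μ R f g) := by
  unfold mulL
  simp only [ContinuousLinearMap.flip_apply,
    ContinuousLinearMap.extend_eq _ (denseRange_q μ R) (isUniformInducing_q μ R)]
  rfl

theorem norm_mulL_le (a b : CrossedProduct μ R) : ‖mulL μ R a b‖ ≤ ‖a‖ * ‖b‖ := by
  refine (denseRange_q μ R).induction_on₂ (p := fun a b => ‖mulL μ R a b‖ ≤ ‖a‖ * ‖b‖)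
    (isClosed_le (by fun_prop) (by fun_prop)) (fun f g => ?_) a b
  rw [mulL_q, norm_q, norm_q, norm_q]
  exact sigma_conv_le μ R f g

theorem mulL_assoc (a b c : CrossedProduct μ R) :
    mulL μ R (mulL μ R a b) c = mulL μ R a (mulL μ R b c) := by
  refine (denseRange_q μ R).induction_on₃
    (p := fun a b c => mulL μ R (mulL μ R a b) c = mulL μ R a (mulL μ R b c))
    (isClosed_eq (by fun_prop) (by fun_prop)) (fun f g h => ?_) a b c
  rw [mulL_q, mulL_q, mulL_q, mulL_q, ← sub_eq_zero, ← map_sub, ← norm_eq_zero, norm_q]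
  refine sigma_eq_zero μ R fun ρ _ => ?_
  have key : ∀ f g h : C_c(G, A), ρ.integratedForm μ (twistedConv μ 𝔖 (twistedConv μ 𝔖 f g) h) -
      ρ.integratedForm μ (twistedConv μ 𝔖 f (twistedConv μ 𝔖 g h)) = 0 := fun f g h => by
    simp only [ρ.integratedForm_conv μ, mul_assoc, sub_self]
  exact (map_sub (ρ.integratedForm μ) (twistedConv μ 𝔖 (twistedConv μ 𝔖 f g) h)
    (twistedConv μ 𝔖 f (twistedConv μ 𝔖 g h))).trans (key f g h)

instance : NonUnitalNormedRing (CrossedProduct μ R) :=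
  { (inferInstance : NormedAddCommGroup (CrossedProduct μ R)) with
    mul := fun a b => mulL μ R a b
    left_distrib := fun a b c => map_add (mulL μ R a) b c
    right_distrib := fun a b c => (mulL μ R).map_add₂ a b c
    zero_mul := fun a => (mulL μ R).map_zero₂ a
    mul_zero := fun a => map_zero (mulL μ R a)
    mul_assoc := mulL_assoc μ R
    norm_mul_le := norm_mulL_le μ R }

theorem mul_def (a b : CrossedProduct μ R) : a * b = mulL μ R a b := rfl

instance : IsScalarTower 𝕜 (CrossedProduct μ R) (CrossedProduct μ R) where
  smul_assoc c a b := (mulL μ R).map_smul₂ c a b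

instance : SMulCommClass 𝕜 (CrossedProduct μ R) (CrossedProduct μ R) where
  smul_comm c a b := (map_smul (mulL μ R a) c b).symm

/-- `q^R` is multiplicative. -/
theorem q_mul (f g : C_c(G, A)) :
    q μ R (twistedConv μ 𝔖 f g : C_c(G, A)) = q μ R f * q μ R g := (mulL_q μ R f g).symm

end CrossedProduct

end

/-! ### The left centralizer algebra and the left regular representation -/

section LeftCentralizer

variable (𝕜 : Type*) [RCLike 𝕜] (B : Type*) [NonUnitalNormedRing B] [NormedSpace 𝕜 B]
  [IsScalarTower 𝕜 B B] [SMulCommClass 𝕜 B B]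

/-- The left centralizer algebra `M_l(B)`: all bounded operators `L` on `B` with
`L (a b) = (L a) b`, with the operator norm. -/
def leftCentralizer : Subalgebra 𝕜 (B →L[𝕜] B) where
  carrier := {L | ∀ a b, L (a * b) = L a * b}
  mul_mem' {L L'} h h' a b := by
    change L (L' (a * b)) = L (L' a) * b
    rw [h', h]
  add_mem' {L L'} h h' a b := by
    change L (a * b) + L' (a * b) = (L a + L' a) * b
    rw [h, h', add_mul]
  algebraMap_mem' c a b := by
    change c • (a * b) = (c • a) * b
    rw [smul_mul_assoc]

/-- The left regular representation `λ : B → M_l(B)`, `λ(a) b = a b`. -/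
def leftRegular : B →ₙₐ[𝕜] leftCentralizer 𝕜 B where
  toFun a := ⟨ContinuousLinearMap.mul 𝕜 B a, fun b c => (mul_assoc a b c).symm⟩
  map_smul' c a := Subtype.ext (map_smul (ContinuousLinearMap.mul 𝕜 B) c a)
  map_zero' := Subtype.ext (map_zero (ContinuousLinearMap.mul 𝕜 B))
  map_add' a b := Subtype.ext (map_add (ContinuousLinearMap.mul 𝕜 B) a b)
  map_mul' a b := Subtype.ext (ContinuousLinearMap.ext fun c => mul_assoc a b c)

end LeftCentralizer

end BanachCrossedProduct

end

/-!
The norm of `q f` is the supremum of `‖(π ⋊ U)(f)‖` over `R`, so it suffices to bound every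
`‖(π ⋊ U)(f)‖` by a constant multiple of `‖λ(q f)‖`. If `σ^R(u) ≤ L`, then
`(π ⋊ U)(f) (π ⋊ U)(u) = (π ⋊ U)(f * u)` has norm at most `L ‖λ(q f)‖`; hence the constant `L`
works as soon as, for every member of `R`, each vector `x` is a limit of vectors `(π ⋊ U)(u) x`
with `σ^R(u) ≤ L`. Such `u` are `z ⊗ a`, with `a` from the approximate left identity of `A` and `z`
a probability density concentrated near the identity of `G`: shrinking the support of `z` turns
`(π ⋊ U)(z ⊗ a) x` into `π(a) x`, and `π(a) x` tends to `x` by non-degeneracy.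
-/

namespace BanachCrossedProduct

/-! ### Strong convergence of bounded families of operators -/

section StrongConvergence

variable {𝕜 : Type*} [NontriviallyNormedField 𝕜]
  {E : Type*} [SeminormedAddCommGroup E] [NormedSpace 𝕜 E]
  {F : Type*} [SeminormedAddCommGroup F] [NormedSpace 𝕜 F]

theorem isClosed_setOf_tendsto_apply {ι : Type*} {l : Filter ι} {T : ι → E →L[𝕜] F} {M : ℝ}
    (hT : ∀ᶠ i in l, ‖T i‖ ≤ M) (S : E →L[𝕜] F) :
    IsClosed {x | Tendsto (fun i => T i x) l (𝓝 (S x))} := by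
  let bounded : Set ι := {i | ‖T i‖ ≤ M}
  have hnorm : ∃ C, ∀ i : bounded, ‖T i‖ ≤ C := ⟨M, Subtype.property⟩
  have hequi : Equicontinuous fun (i : bounded) x => T i x :=
    ((NormedSpace.equicontinuous_TFAE fun i : bounded => T i).out 5 1).1 hnorm
  have hl : map ((↑) : bounded → ι) (comap (↑) l) = l :=
    map_comap_of_mem (by rwa [Subtype.range_coe])
  have hclosed := hequi.isClosed_setOfPred_tendsto (l := comap (↑) l) S.continuous
  convert hclosed using 3 with x
  conv_lhs => rw [← hl, tendsto_map'_iff]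
  rfl

theorem tendsto_apply_of_dense_span {ι : Type*} {l : Filter ι} {T : ι → E →L[𝕜] F} {M : ℝ}
    (hT : ∀ᶠ i in l, ‖T i‖ ≤ M) {S : E →L[𝕜] F} {s : Set E}
    (hs : Dense (Submodule.span 𝕜 s : Set E))
    (hTS : ∀ x ∈ s, Tendsto (fun i => T i x) l (𝓝 (S x))) (x : E) :
    Tendsto (fun i => T i x) l (𝓝 (S x)) := by
  have hspan : (Submodule.span 𝕜 s : Set E) ⊆ {x | Tendsto (fun i => T i x) l (𝓝 (S x))} := by
    intro y hy
    induction hy using Submodule.span_induction with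
    | mem y hy => exact hTS y hy
    | zero => simpa only [mem_ofPred_eq, map_zero] using tendsto_const_nhds
    | add y y' _ _ h h' => simpa only [mem_ofPred_eq, map_add] using Tendsto.add h h'
    | smul c y _ h => simpa only [mem_ofPred_eq, map_smul] using Tendsto.const_smul h c
  exact (isClosed_setOf_tendsto_apply hT S).closure_subset_iff.2 hspan (hs x)

theorem opNorm_le_of_forall_mem_closure {T : E →L[𝕜] F} {S : Set (E →L[𝕜] E)} {c : ℝ}
    (hS : ∀ x, x ∈ closure ((fun s => s x) '' S)) (hTS : ∀ s ∈ S, ‖T.comp s‖ ≤ c) :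
    ‖T‖ ≤ c := by
  have hc : 0 ≤ c := by
    obtain ⟨s, hs⟩ := (closure_nonempty_iff.1 ⟨0, hS 0⟩).of_image
    exact (norm_nonneg _).trans (hTS s hs)
  refine T.opNorm_le_bound hc fun x => ?_
  have hclosed : IsClosed {y | ‖T y‖ ≤ c * ‖x‖} := isClosed_le (by fun_prop) continuous_const
  refine closure_minimal ?_ hclosed (hS x)
  rintro _ ⟨s, hs, rfl⟩
  exact (T.comp s).le_of_opNorm_le (hTS s hs) x

end StrongConvergence

/-! ### Averages against densities concentrated near a point -/

section Densities

variable {X : Type*} [TopologicalSpace X] [MeasurableSpace X]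

/-- The continuous compactly supported probability densities with respect to `μ` whose support
lies in `V`; those for small neighbourhoods `V` of a point approximate its Dirac measure. -/
def densitiesIn (μ : Measure X) (V : Set X) : Set C_c(X, ℝ) :=
  {z | tsupport z ⊆ V ∧ (∀ s, 0 ≤ z s) ∧ ∫ s, z s ∂μ = 1}

variable [OpensMeasurableSpace X] {μ : Measure X} [IsFiniteMeasureOnCompacts μ]

theorem densitiesIn_nonempty [R1Space X] [LocallyCompactSpace X] [μ.IsOpenPosMeasure]
    {V : Set X} {x : X} (hV : V ∈ 𝓝 x) : (densitiesIn μ V).Nonempty := by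
  obtain ⟨f, hf1, hfc, hfV, hf01⟩ := exists_continuousMap_one_of_isCompact_subset_isOpen
    isCompact_singleton isOpen_interior (singleton_subset_iff.2 (mem_interior_iff_mem_nhds.2 hV))
  have hfx : f x ≠ 0 := ne_of_eq_of_ne (hf1 rfl) one_ne_zero
  let z : C_c(X, ℝ) := ⟨f, hfc⟩
  have hpos : 0 < ∫ s, z s ∂μ :=
    f.continuous.integral_pos_of_hasCompactSupport_nonneg_nonzero hfc
      (fun s => (hf01 s).1) hfx
  refine ⟨(∫ s, z s ∂μ)⁻¹ • z, ?_, fun s => ?_, ?_⟩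
  · exact (closure_mono (Function.support_const_smul_subset _ z)).trans
      (hfV.trans interior_subset)
  · exact mul_nonneg (inv_nonneg.2 hpos.le) (hf01 s).1
  · simp only [CompactlySupportedContinuousMap.smul_apply, smul_eq_mul]
    rw [integral_const_mul, inv_mul_cancel₀ hpos.ne']

theorem norm_integral_smul_sub_le {E : Type*} [NormedAddCommGroup E] [NormedSpace ℝ E]
    [CompleteSpace E] {V : Set X} {z : C_c(X, ℝ)} (hz : z ∈ densitiesIn μ V) {F : X → E}
    (hF : Continuous F) {y : E} {δ : ℝ} (hδ : ∀ s ∈ V, ‖F s - y‖ ≤ δ) :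
    ‖(∫ s, z s • F s ∂μ) - y‖ ≤ δ := by
  obtain ⟨hzV, hz0, hz1⟩ := hz
  have hint : ∀ {H : X → E}, Continuous H → Integrable (fun s => z s • H s) μ := fun hH =>
    (z.continuous.smul hH).integrable_of_hasCompactSupport z.hasCompactSupport.smul_right
  have hsub : (∫ s, z s • F s ∂μ) - y = ∫ s, z s • (F s - y) ∂μ := by
    simp only [smul_sub]
    rw [integral_sub (hint hF) (hint continuous_const), integral_smul_const, hz1, one_smul]
  have hbound : ∀ s, ‖z s • (F s - y)‖ ≤ z s * δ := fun s => by
    rw [norm_smul, Real.norm_of_nonneg (hz0 s)]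
    by_cases hs : s ∈ tsupport z
    · exact mul_le_mul_of_nonneg_left (hδ s (hzV hs)) (hz0 s)
    · simp [image_eq_zero_of_notMem_tsupport hs]
  calc ‖(∫ s, z s • F s ∂μ) - y‖ = ‖∫ s, z s • (F s - y) ∂μ‖ := by rw [hsub]
    _ ≤ ∫ s, z s * δ ∂μ := norm_integral_le_of_norm_le
      ((z.continuous.integrable_of_hasCompactSupport z.hasCompactSupport).mul_const δ)
      (Eventually.of_forall hbound)
    _ = δ := by rw [integral_mul_const, hz1, one_mul]

theorem mem_closure_integral_smul [R1Space X] [LocallyCompactSpace X] [μ.IsOpenPosMeasure]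
    {E : Type*} [NormedAddCommGroup E] [NormedSpace ℝ E] [CompleteSpace E] {F : X → E}
    (hF : Continuous F) {V : Set X} {x : X} (hV : V ∈ 𝓝 x) :
    F x ∈ closure ((fun z : C_c(X, ℝ) => ∫ s, z s • F s ∂μ) '' densitiesIn μ V) := by
  refine (mem_closure_iff_nhds_basis Metric.nhds_basis_closedBall).2 fun δ hδ => ?_
  have hnear : F ⁻¹' Metric.closedBall (F x) δ ∈ 𝓝 x :=
    hF.continuousAt (Metric.closedBall_mem_nhds _ hδ)
  obtain ⟨z, hz⟩ := densitiesIn_nonempty (μ := μ) (inter_mem hV hnear)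
  refine ⟨_, ⟨z, ⟨hz.1.trans inter_subset_left, hz.2⟩, rfl⟩, mem_closedBall_iff_norm.2 ?_⟩
  exact norm_integral_smul_sub_le hz hF fun s hs => mem_closedBall_iff_norm.1 hs.2

end Densities

section ElementaryTensor

variable (𝕜 : Type*) [RCLike 𝕜] {X : Type*} [TopologicalSpace X]
  {E : Type*} [NormedAddCommGroup E] [NormedSpace 𝕜 E]

/-- The elementary tensor `z ⊗ a`, that is, the function `s ↦ z(s) a`. The density `z` is taken
real-valued for both choices of `𝕜`. -/
noncomputable def elementaryTensor (z : C_c(X, ℝ)) (a : E) : C_c(X, E) :=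
  z.compLeft (⟨fun t : ℝ => (t : 𝕜) • a, by fun_prop⟩ : C(ℝ, E))

theorem elementaryTensor_apply (z : C_c(X, ℝ)) (a : E) (s : X) :
    elementaryTensor 𝕜 z a s = (z s : 𝕜) • a :=
  CompactlySupportedContinuousMap.compLeft_apply (by simp) z s

theorem tsupport_elementaryTensor_subset (z : C_c(X, ℝ)) (a : E) :
    tsupport (elementaryTensor 𝕜 z a) ⊆ tsupport z :=
  closure_mono fun s hs h => hs (by simp [elementaryTensor_apply, h])

theorem integral_norm_elementaryTensor [MeasurableSpace X] {μ : Measure X} {V : Set X}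
    {z : C_c(X, ℝ)} (hz : z ∈ densitiesIn μ V) (a : E) :
    ∫ s, ‖elementaryTensor 𝕜 z a s‖ ∂μ = ‖a‖ := by
  obtain ⟨-, hz0, hz1⟩ := hz
  simp only [elementaryTensor_apply, norm_smul, RCLike.norm_ofReal, abs_of_nonneg (hz0 _)]
  rw [integral_mul_const, hz1, one_mul]

end ElementaryTensor

/-! ### Approximation of the identity by integrated forms -/

section

universe w

variable {𝕜 : Type*} [RCLike 𝕜] {A : Type*} [NonUnitalNormedRing A] [NormedSpace 𝕜 A]
  {G : Type*} [Group G] [TopologicalSpace G] {𝔖 : DynamicalSystem 𝕜 A G}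

theorem ContCovRep.IsNondegenerate.tendsto_π_apply {ρ : ContCovRep.{w} 𝔖}
    (hρ : ρ.IsNondegenerate) {l : Filter A} {M : ℝ} (hM : ∀ᶠ u in l, ‖u‖ ≤ M)
    (hl : ∀ a, Tendsto (fun u => u * a) l (𝓝 a)) (x : ρ.X) :
    Tendsto (fun u => ρ.π u x) l (𝓝 x) := by
  have hbound : ∀ᶠ u in l, ‖ρ.π u‖ ≤ ‖ρ.π‖ * M := hM.mono fun u hu => ρ.π.le_opNorm_of_le hu
  refine tendsto_apply_of_dense_span hbound (S := .id 𝕜 ρ.X) hρ ?_ x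
  rintro _ ⟨a, x, rfl⟩
  have hπ : Continuous fun b => ρ.π b x := ρ.π.continuous.clm_apply continuous_const
  refine ((hπ.tendsto a).comp (hl a)).congr fun u => ?_
  rw [Function.comp_apply, ρ.π_mul, mul_apply_eq_comp]

theorem HasBoundedApproxLeftIdentity.exists_forall_mem_closure_π_apply
    (hA : HasBoundedApproxLeftIdentity A) : ∃ M : ℝ, ∀ ρ : ContCovRep.{w} 𝔖, ρ.IsNondegenerate →
      ∀ x, x ∈ closure ((fun a => ρ.π a x) '' Metric.closedBall 0 M) := by
  obtain ⟨l, _, ⟨M, hM⟩, hl⟩ := hA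
  exact ⟨M, fun ρ hρ x => mem_closure_of_tendsto (hρ.tendsto_π_apply hM hl x)
    (hM.mono fun u hu => mem_image_of_mem _ (mem_closedBall_zero_iff.2 hu))⟩

theorem UniformlyBoundedClass.exists_norm_le (R : UniformlyBoundedClass.{w} 𝔖) {K : Set G}
    (hK : IsCompact K) : ∃ C N : ℝ, 0 ≤ C ∧ 0 ≤ N ∧
      ∀ ρ ∈ R.carrier, ‖ρ.π‖ ≤ C ∧ ∀ s ∈ K, ‖ρ.U s‖ ≤ N := by
  obtain ⟨C, ν, hC, -, hν, hR⟩ := R.bounded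
  obtain ⟨N, hN⟩ := hν K hK
  exact ⟨C, max N 0, hC, le_max_right _ _, fun ρ hρ => ⟨(hR ρ hρ).1, fun s hs =>
    ((hR ρ hρ).2 s).trans ((hN (mem_image_of_mem ν hs)).trans (le_max_left _ _))⟩⟩

end

section

universe w

variable {𝕜 : Type*} [RCLike 𝕜] {A : Type*} [NonUnitalNormedRing A] [NormedSpace 𝕜 A]
  [IsScalarTower 𝕜 A A] [SMulCommClass 𝕜 A A] [CompleteSpace A]
  {G : Type*} [Group G] [TopologicalSpace G] [IsTopologicalGroup G] [LocallyCompactSpace G]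
  [T2Space G] [MeasurableSpace G] [BorelSpace G]
  (μ : Measure G) [μ.IsHaarMeasure] {𝔖 : DynamicalSystem 𝕜 A G}

theorem ContCovRep.norm_integratedForm_le (ρ : ContCovRep.{w} 𝔖) (f : C_c(G, A)) {C N : ℝ}
    (hC : ‖ρ.π‖ ≤ C) (hN0 : 0 ≤ N) (hN : ∀ s ∈ tsupport f, ‖ρ.U s‖ ≤ N) :
    ‖ρ.integratedForm μ f‖ ≤ C * N * ∫ s, ‖f s‖ ∂μ := by
  have hC0 : 0 ≤ C := (norm_nonneg ρ.π).trans hC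
  exact (ρ.integratedForm μ f).opNorm_le_bound (by positivity) (ρ.norm_integrated_le μ f hC hN)

theorem ContCovRep.integratedForm_elementaryTensor_apply (ρ : ContCovRep.{w} 𝔖)
    (z : C_c(G, ℝ)) (a : A) (x : ρ.X) :
    ρ.integratedForm μ (elementaryTensor 𝕜 z a) x =
      integralK 𝕜 μ fun s => (z s : 𝕜) • ρ.π a (ρ.U s x) := by
  simp only [ρ.integratedForm_apply μ, elementaryTensor_apply, map_smul,
    smul_apply]

theorem ContCovRep.π_apply_mem_closure (ρ : ContCovRep.{w} 𝔖) {V : Set G} (hV : V ∈ 𝓝 1)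
    (a : A) (x : ρ.X) : ρ.π a x ∈ closure
      ((fun z => ρ.integratedForm μ (elementaryTensor 𝕜 z a) x) '' densitiesIn μ V) := by
  let _ : NormedSpace ℝ ρ.X := NormedSpace.restrictScalars ℝ 𝕜 ρ.X
  have horbit : Continuous fun s => ρ.π a (ρ.U s x) := (ρ.π a).continuous.comp (ρ.continuous_U x)
  have hmem := mem_closure_integral_smul (μ := μ) horbit hV
  rw [map_one, one_apply_eq_self] at hmem
  simp only [ρ.integratedForm_elementaryTensor_apply μ]
  exact hmem

variable (R : UniformlyBoundedClass.{w} 𝔖)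

theorem norm_integratedForm_le_sigma {ρ : ContCovRep.{w} 𝔖} (hρ : ρ ∈ R.carrier) (f : C_c(G, A)) :
    ‖ρ.integratedForm μ f‖ ≤ sigma μ R f :=
  le_ciSup (bddAbove_norm_integratedForm μ R f) ⟨ρ, hρ⟩

theorem sigma_le {f : C_c(G, A)} {c : ℝ} (h : ∀ ρ ∈ R.carrier, ‖ρ.integratedForm μ f‖ ≤ c) :
    sigma μ R f ≤ c :=
  have : Nonempty R.carrier := R.nonempty.to_subtype
  ciSup_le fun ρ => h ρ.1 ρ.2

theorem exists_forall_mem_closure_integratedForm_apply (hA : HasBoundedApproxLeftIdentity A)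
    (hR : ∀ ρ ∈ R.carrier, ρ.IsNondegenerate) : ∃ L : ℝ, ∀ ρ ∈ R.carrier, ∀ x : ρ.X,
      x ∈ closure ((fun u => ρ.integratedForm μ u x) '' {u | sigma μ R u ≤ L}) := by
  obtain ⟨M, hM⟩ := hA.exists_forall_mem_closure_π_apply (𝔖 := 𝔖)
  obtain ⟨K, hK, hK1⟩ := exists_compact_mem_nhds (1 : G)
  obtain ⟨C, N, hC0, hN0, hCN⟩ := R.exists_norm_le hK
  have hsigma : ∀ a ∈ Metric.closedBall (0 : A) M, ∀ z ∈ densitiesIn μ K,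
      sigma μ R (elementaryTensor 𝕜 z a) ≤ C * N * M := fun a ha z hz => by
    refine sigma_le μ R fun ρ hρ => ?_
    calc ‖ρ.integratedForm μ (elementaryTensor 𝕜 z a)‖
        ≤ C * N * ∫ s, ‖elementaryTensor 𝕜 z a s‖ ∂μ :=
          ρ.norm_integratedForm_le μ _ (hCN ρ hρ).1 hN0 fun s hs =>
            (hCN ρ hρ).2 s (hz.1 (tsupport_elementaryTensor_subset 𝕜 z a hs))
      _ = C * N * ‖a‖ := by rw [integral_norm_elementaryTensor 𝕜 hz]
      _ ≤ C * N * M := by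
          gcongr
          exact mem_closedBall_zero_iff.1 ha
  refine ⟨C * N * M, fun ρ hρ x => closure_minimal ?_ isClosed_closure (hM ρ (hR ρ hρ) x)⟩
  rintro _ ⟨a, ha, rfl⟩
  refine closure_mono ?_ (ρ.π_apply_mem_closure μ hK1 a x)
  rintro _ ⟨z, hz, rfl⟩
  exact ⟨elementaryTensor 𝕜 z a, hsigma a ha z hz, rfl⟩

/-! ### The left regular representation is bounded below -/

namespace CrossedProduct

theorem sigma_twistedConv_le_norm_mul (f u : PreCrossedProduct μ R) :
    sigma μ R (twistedConv μ 𝔖 f u) ≤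
      ‖ContinuousLinearMap.mul 𝕜 (CrossedProduct μ R) (q μ R f)‖ * sigma μ R u :=
  calc sigma μ R (twistedConv μ 𝔖 f u) = ‖q μ R f * q μ R u‖ :=
      (norm_q μ R _).symm.trans (congrArg norm (q_mul μ R f u))
    _ ≤ ‖ContinuousLinearMap.mul 𝕜 (CrossedProduct μ R) (q μ R f)‖ * ‖q μ R u‖ :=
      (ContinuousLinearMap.mul 𝕜 (CrossedProduct μ R) (q μ R f)).le_opNorm _
    _ = ‖ContinuousLinearMap.mul 𝕜 (CrossedProduct μ R) (q μ R f)‖ * sigma μ R u := by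
      rw [norm_q]

variable {L : ℝ} (hL : ∀ ρ ∈ R.carrier, ∀ x : ρ.X,
  x ∈ closure ((fun u => ρ.integratedForm μ u x) '' {u | sigma μ R u ≤ L}))
include hL

theorem sigma_le_mul_norm_mul (f : C_c(G, A)) :
    sigma μ R f ≤ L * ‖ContinuousLinearMap.mul 𝕜 (CrossedProduct μ R) (q μ R f)‖ := by
  refine sigma_le μ R fun ρ hρ => opNorm_le_of_forall_mem_closure
    (S := ρ.integratedForm μ '' {u | sigma μ R u ≤ L}) (fun x => ?_) ?_
  · rw [image_image]
    exact hL ρ hρ x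
  · rintro _ ⟨u, hu, rfl⟩
    calc ‖ρ.integratedForm μ f * ρ.integratedForm μ u‖
        = ‖ρ.integratedForm μ (twistedConv μ 𝔖 f u)‖ := by rw [ρ.integratedForm_conv μ]
      _ ≤ sigma μ R (twistedConv μ 𝔖 f u) := norm_integratedForm_le_sigma μ R hρ _
      _ ≤ ‖ContinuousLinearMap.mul 𝕜 (CrossedProduct μ R) (q μ R f)‖ * sigma μ R u :=
        sigma_twistedConv_le_norm_mul μ R f u
      _ ≤ L * ‖ContinuousLinearMap.mul 𝕜 (CrossedProduct μ R) (q μ R f)‖ := by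
        rw [mul_comm L]
        exact mul_le_mul_of_nonneg_left hu (norm_nonneg _)

theorem norm_le_mul_norm_mul (b : CrossedProduct μ R) :
    ‖b‖ ≤ L * ‖ContinuousLinearMap.mul 𝕜 (CrossedProduct μ R) b‖ :=
  (denseRange_q μ R).induction_on b (isClosed_le (by fun_prop) (by fun_prop)) fun f => by
    rw [norm_q]
    exact sigma_le_mul_norm_mul μ R hL f

end CrossedProduct

end

theorem isEmbedding_leftRegular {𝕜 : Type*} [RCLike 𝕜] {B : Type*} [NonUnitalNormedRing B]
    [NormedSpace 𝕜 B] [IsScalarTower 𝕜 B B] [SMulCommClass 𝕜 B B] {L : ℝ}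
    (hL : ∀ b : B, ‖b‖ ≤ L * ‖ContinuousLinearMap.mul 𝕜 B b‖) :
    IsEmbedding (leftRegular 𝕜 B) := by
  have hmul : AntilipschitzWith L.toNNReal (ContinuousLinearMap.mul 𝕜 B) :=
    AddMonoidHomClass.antilipschitz_of_bound _ fun b =>
      (hL b).trans (mul_le_mul_of_nonneg_right (Real.le_coe_toNNReal L) (norm_nonneg _))
  have hcont : Continuous (ContinuousLinearMap.mul 𝕜 B) := (ContinuousLinearMap.mul 𝕜 B).continuous
  exact .of_comp (hcont.subtype_mk fun a => (leftRegular 𝕜 B a).2) continuous_subtype_val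
    (hmul.isEmbedding hcont)

end BanachCrossedProduct

theorem mainTheorem9 {𝕜 : Type*} [RCLike 𝕜]
    {A : Type*} [NonUnitalNormedRing A] [NormedSpace 𝕜 A] [IsScalarTower 𝕜 A A]
    [SMulCommClass 𝕜 A A] [CompleteSpace A]
    {G : Type*} [Group G] [TopologicalSpace G] [IsTopologicalGroup G] [LocallyCompactSpace G]
    [T2Space G] [MeasurableSpace G] [BorelSpace G] (μ : Measure G) [μ.IsHaarMeasure]
    (𝔖 : BanachCrossedProduct.DynamicalSystem 𝕜 A G)
    (hA : BanachCrossedProduct.HasBoundedApproxLeftIdentity A)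
    (R : BanachCrossedProduct.UniformlyBoundedClass 𝔖)
    (hR : ∀ ρ ∈ R.carrier, ρ.IsNondegenerate) :
    IsEmbedding (BanachCrossedProduct.leftRegular 𝕜 (BanachCrossedProduct.CrossedProduct μ R)) := by
  obtain ⟨L, hL⟩ :=
    BanachCrossedProduct.exists_forall_mem_closure_integratedForm_apply μ R hA hR
  exact BanachCrossedProduct.isEmbedding_leftRegular
    (BanachCrossedProduct.CrossedProduct.norm_le_mul_norm_mul μ R hL)
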